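/- Let $\mathbb{K}\in\{\mathbb{R},\mathbb{C}\}$, $m\ge 0$, $X=\{x_0,x_1,\dots,x_m\}$, and let $X^*$ be the set of words over $X$. Let $\mathbb{K}^m\langle\langle X\rangle\rangle$ be the space of all maps $c\colon X^*\to\mathbb{K}^m$, $\eta\mapsto (c,\eta)$, written $c=\sum_{\eta}(c,\eta)\eta$, with the topology of coefficientwise convergence. For $d\in\mathbb{K}^m\langle\langle X\rangle\rangle$ let $d[j]\in\mathbb{K}\langle\langle X\rangle\rangle$ ($1\le j\le m$) be its $j$-th component and put $d[0]:=0$. Let $\sqcup\!\sqcup$ denote the shuffle product of scalar series, i.e. the (locally finite) bilinear extension of $\emptyset\sqcup\!\sqcup\eta=\eta\sqcup\!\sqcup\emptyset=\eta$, $(x_i\eta)\sqcup\!\sqcup(x_j\xi)=x_i(\eta\sqcup\!\sqcup x_j\xi)+x_j(x_i\eta\sqcup\!\sqcup\xi)$. For a word $\eta$ define $\phi_d(\eta)\in \mathrm{End}(\mathbb{K}\langle\langle X\rangle\rangle)$ by $\phi_d(\emptyset)=\mathrm{id}$, $\phi_d(x_i\eta)=\phi_d(x_i)\circ\phi_d(\eta)$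 and $\phi_d(x_i)(e)=x_ie+x_0(d[i]\sqcup\!\sqcup e)$, and set $$c\,\tilde\circ\, d_\delta=\sum_{\eta\in X^*}(c,\eta)\,\phi_d(\eta)(1),\qquad (\delta+c)\circ(\delta+d)=\delta+d+c\,\tilde\circ\, d_\delta .$$ Define the (Foissy) pre-Lie product by $c\lhd d=\sum_{\eta\in X^*}(c,\eta)\,(\eta\lhd d)$, where $\emptyset\lhd d=0$ and $$(x_i\eta)\lhd d=x_i(\eta\lhd d)+x_0(\eta\sqcup\!\sqcup d[i]),\qquad i=0,\dots,m.$$ Then $\mathbb{K}^m\langle\langle X\rangle\rangle$ is a Fréchet space and $\delta+\mathbb{K}^m\langle\langle X\rangle\rangle$, with the product $\circ$, the unit $\delta$ and the global chart $\delta+c\mapsto c$, is a $C^\infty_{\mathbb{K}}$-Lie group (in the sense of Bastiani calculus) modelled on this space. Its Lie algebra is $\mathbb{K}^m\langle\langle X\rangle\rangle$ (the tangent space at $\delta$) with the Lie bracket $$[c,d]=c\lhd d-d\lhd c .$$ That is, this bracket is a Lie bracket; evaluation at $\delta$ is a bijection from the smooth left invariant vector fields onto $\mathbb{K}^m\langle\langle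 X\rangle\rangle$; and for left invariant fields $V,W$ the field $[V,W]=dW(V)-dV(W)$ is left invariant with $[V,W](\delta)=[V(\delta),W(\delta)]$. Moreover, $\lhd$ is bilinear and is the linear part of the group product: $(\delta+c)\circ(\delta+d)=\delta+c+d+c\lhd d+R(c,d)$, where $R(c,d)$ is linear in $c$ and of order at least two in $d$, i.e. every coefficient of $R(c,td)$ is $t^2$ times a polynomial in $t\in\mathbb{K}$. -/

import Mathlib

open Filter Topology

namespace ChenFliess

noncomputable section

/-! ### Words and formal power series -/

/-- Words over the alphabet `X = {x_0, x_1, …, x_m}`; the letter `x_i` is `i : Fin (m + 1)`,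
concatenation is `++` and the empty word is `[]`. -/
abbrev Word (m : ℕ) : Type := List (Fin (m + 1))

/-- Scalar series `𝕜⟨⟨X⟩⟩`: `(c, η)` is `c η`. -/
abbrev ScalarSeries (𝕜 : Type*) (m : ℕ) : Type _ := Word m → 𝕜

/-- `𝕜^m⟨⟨X⟩⟩`, the series with coefficients in `𝕜^m`. Its vector space operations and its topology
are Mathlib's for a product of copies of `𝕜^m` indexed by the (countably many) words: this is the
Fréchet topology of coefficientwise convergence. -/
abbrev Series (𝕜 : Type*) (m : ℕ) : Type _ := Word m → Fin m → 𝕜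

variable {𝕜 : Type*} [RCLike 𝕜] {m : ℕ}

/-- The word `η` as a series. -/
def word (η : Word m) : ScalarSeries 𝕜 m := fun ζ => if ζ = η then 1 else 0

/-- The series `x_i e`. -/
def prepend (i : Fin (m + 1)) (e : ScalarSeries 𝕜 m) : ScalarSeries 𝕜 m
  | [] => 0
  | j :: ζ => if j = i then e ζ else 0

/-- The shuffle product of two words. -/
def wordShuffle : Word m → Word m → ScalarSeries 𝕜 m
  | [], ξ => word ξ
  | i :: η, [] => word (i :: η)
  | i :: η, j :: ξ =>
      prepend i (wordShuffle η (j :: ξ)) + prepend j (wordShuffle (i :: η) ξ)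
termination_by η ξ => η.length + ξ.length

/-- The shuffle product of two series, `∑_{η, ξ} (c, η) (d, ξ) η ⧢ ξ`. Every coefficient is a finite
sum, see `finite_support_shuffle`. -/
def shuffle (c d : ScalarSeries 𝕜 m) : ScalarSeries 𝕜 m := fun ν =>
  ∑ᶠ p : Word m × Word m, c p.1 * d p.2 * wordShuffle p.1 p.2 ν

/-- The component `d[i]` for `i = 0, …, m`, with the convention `d[0] = 0`; `d[j]` for
`j = 1, …, m` is the series of `j`-th coordinates. -/
def component (d : Series 𝕜 m) (i : Fin (m + 1)) : ScalarSeries 𝕜 m := fun η =>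
  Fin.cases 0 (d η) i

/-! ### The mixed composition product and the pre-Lie product -/

/-- `φ_d(η)(1)`, where `φ_d(x_i)(e) = x_i e + x_0 (d[i] ⧢ e)` and
`φ_d(x_i η) = φ_d(x_i) ∘ φ_d(η)`. -/
def wordMixedComp (d : Series 𝕜 m) : Word m → ScalarSeries 𝕜 m
  | [] => word []
  | i :: η =>
      prepend i (wordMixedComp d η) + prepend 0 (shuffle (component d i) (wordMixedComp d η))

/-- The mixed composition product `∑_η (c, η) φ_d(η)(1)` of `c` with `δ + d`. Every coefficient is
a finite sum, see `finite_support_mixedComp`. -/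
def mixedComp (c d : Series 𝕜 m) : Series 𝕜 m := fun ν =>
  ∑ᶠ η : Word m, wordMixedComp d η ν • c η

/-- `η ◁ d` for a word `η`. For the letter `x_0` the second summand vanishes as `d[0] = 0`. -/
def wordPreLie (d : Series 𝕜 m) : Word m → ScalarSeries 𝕜 m
  | [] => 0
  | i :: η => prepend i (wordPreLie d η) + prepend 0 (shuffle (word η) (component d i))

/-- The pre-Lie product `c ◁ d = ∑_η (c, η) (η ◁ d)`. Every coefficient is a finite sum, see
`finite_support_preLie`. -/
def preLie (c d : Series 𝕜 m) : Series 𝕜 m := fun ν =>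
  ∑ᶠ η : Word m, wordPreLie d η ν • c η

/-! ### Local finiteness of the sums above -/

theorem prepend_ne_zero {i : Fin (m + 1)} {e : ScalarSeries 𝕜 m} {ν : Word m}
    (h : prepend i e ν ≠ 0) : ∃ ζ, ν = i :: ζ ∧ e ζ ≠ 0 := by
  cases ν with
  | nil => simp [prepend] at h
  | cons j ζ =>
    by_cases hj : j = i
    · subst hj
      exact ⟨ζ, rfl, by simpa [prepend] using h⟩
    · simp [prepend, hj] at h

theorem length_of_wordShuffle_ne_zero (η ξ ν : Word m)
    (h : (wordShuffle η ξ ν : 𝕜) ≠ 0) : ν.length = η.length + ξ.length := by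
  induction η, ξ using wordShuffle.induct generalizing ν with
  | case1 ξ =>
    have : ν = ξ := by
      by_contra hne
      simp [wordShuffle, word, hne] at h
    simp [this]
  | case2 i η =>
    have : ν = i :: η := by
      by_contra hne
      simp [wordShuffle, word, hne] at h
    simp [this]
  | case3 i η j ξ ih1 ih2 =>
    rw [wordShuffle, Pi.add_apply] at h
    by_cases h1 : (prepend i (wordShuffle η (j :: ξ)) ν : 𝕜) = 0
    · rw [h1, zero_add] at h
      obtain ⟨ζ, rfl, hζ⟩ := prepend_ne_zero h
      have := ih2 ζ hζ
      simp only [List.length_cons] at this ⊢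
      omega
    · obtain ⟨ζ, rfl, hζ⟩ := prepend_ne_zero h1
      have := ih1 ζ hζ
      simp only [List.length_cons] at this ⊢
      omega

theorem finite_support_shuffle (c d : ScalarSeries 𝕜 m) (ν : Word m) :
    (Function.support fun p : Word m × Word m =>
      c p.1 * d p.2 * (wordShuffle p.1 p.2 ν : 𝕜)).Finite := by
  refine ((List.finite_length_le (Fin (m + 1)) ν.length).prod
    (List.finite_length_le (Fin (m + 1)) ν.length)).subset ?_
  intro p hp
  have hne : (wordShuffle p.1 p.2 ν : 𝕜) ≠ 0 := right_ne_zero_of_mul hp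
  have := length_of_wordShuffle_ne_zero _ _ _ hne
  simp only [Set.mem_prod, Set.mem_ofPred_eq]
  omega

theorem exists_of_shuffle_ne_zero {c d : ScalarSeries 𝕜 m} {ν : Word m}
    (h : shuffle c d ν ≠ 0) :
    ∃ η ξ, c η ≠ 0 ∧ d ξ ≠ 0 ∧ ν.length = η.length + ξ.length := by
  obtain ⟨p, hp⟩ : ∃ p : Word m × Word m, c p.1 * d p.2 * (wordShuffle p.1 p.2 ν : 𝕜) ≠ 0 := by
    by_contra! hall
    exact h (by simp [shuffle, hall])
  have hcd := left_ne_zero_of_mul hp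
  exact ⟨p.1, p.2, left_ne_zero_of_mul hcd, right_ne_zero_of_mul hcd,
    length_of_wordShuffle_ne_zero _ _ _ (right_ne_zero_of_mul hp)⟩

theorem length_le_of_wordMixedComp_ne_zero (d : Series 𝕜 m) (η ν : Word m)
    (h : wordMixedComp d η ν ≠ 0) : η.length ≤ ν.length := by
  induction η generalizing ν with
  | nil => simp
  | cons i η ih =>
    rw [wordMixedComp, Pi.add_apply] at h
    by_cases h1 : prepend i (wordMixedComp d η) ν = 0
    · rw [h1, zero_add] at h
      obtain ⟨ζ, rfl, hζ⟩ := prepend_ne_zero h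
      obtain ⟨_, ξ, _, hξ, hl⟩ := exists_of_shuffle_ne_zero hζ
      have := ih ξ hξ
      simp only [List.length_cons]
      omega
    · obtain ⟨ζ, rfl, hζ⟩ := prepend_ne_zero h1
      simpa using ih ζ hζ

theorem length_le_of_wordPreLie_ne_zero (d : Series 𝕜 m) (η ν : Word m)
    (h : wordPreLie d η ν ≠ 0) : η.length ≤ ν.length := by
  induction η generalizing ν with
  | nil => simp
  | cons i η ih =>
    rw [wordPreLie, Pi.add_apply] at h
    by_cases h1 : prepend i (wordPreLie d η) ν = 0
    · rw [h1, zero_add] at h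
      obtain ⟨ζ, rfl, hζ⟩ := prepend_ne_zero h
      obtain ⟨ρ, ξ, hρ, _, hl⟩ := exists_of_shuffle_ne_zero hζ
      have hρη : ρ = η := by
        by_contra hne
        simp [word, hne] at hρ
      subst hρη
      simp only [List.length_cons]
      omega
    · obtain ⟨ζ, rfl, hζ⟩ := prepend_ne_zero h1
      simpa using ih ζ hζ

theorem finite_support_mixedComp (c d : Series 𝕜 m) (ν : Word m) :
    (Function.support fun η : Word m => wordMixedComp d η ν • c η).Finite := by
  refine (List.finite_length_le (Fin (m + 1)) ν.length).subset fun η hη => ?_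
  exact length_le_of_wordMixedComp_ne_zero d η ν (left_ne_zero_of_smul hη)

theorem finite_support_preLie (c d : Series 𝕜 m) (ν : Word m) :
    (Function.support fun η : Word m => wordPreLie d η ν • c η).Finite := by
  refine (List.finite_length_le (Fin (m + 1)) ν.length).subset fun η hη => ?_
  exact length_le_of_wordPreLie_ne_zero d η ν (left_ne_zero_of_smul hη)

/-! ### The set `δ + 𝕜^m⟨⟨X⟩⟩` and its composition product -/

/-- The affine space `δ + 𝕜^m⟨⟨X⟩⟩`; its element `δ + c` is `⟨c⟩`. -/
@[ext]
structure UnitalSeries (𝕜 : Type*) (m : ℕ) where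
  toSeries : Series 𝕜 m

/-- The global chart `δ + c ↦ c`, which defines the manifold structure of `δ + 𝕜^m⟨⟨X⟩⟩`. -/
def UnitalSeries.chart (𝕜 : Type*) (m : ℕ) : UnitalSeries 𝕜 m ≃ Series 𝕜 m where
  toFun := UnitalSeries.toSeries
  invFun := UnitalSeries.mk
  left_inv _ := rfl
  right_inv _ := rfl

/-- The element `δ = δ + 0`. -/
def UnitalSeries.delta : UnitalSeries 𝕜 m := ⟨0⟩

/-- The product `(δ + c) ∘ (δ + d) = δ + d + (mixed composition of c with δ + d)`. -/
def UnitalSeries.comp (a b : UnitalSeries 𝕜 m) : UnitalSeries 𝕜 m :=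
  ⟨b.toSeries + mixedComp a.toSeries b.toSeries⟩

end

/-! ### Calculus on locally convex spaces -/

section Calculus

variable (𝕜 : Type*) [RCLike 𝕜] {E F : Type*}
  [AddCommGroup E] [Module 𝕜 E] [TopologicalSpace E]
  [AddCommGroup F] [Module 𝕜 F] [TopologicalSpace F]

/-- `f` has at `x` the directional derivative `z` in the direction `v`. -/
def HasDirDerivAt (f : E → F) (x v : E) (z : F) : Prop :=
  Tendsto (fun t : 𝕜 => t⁻¹ • (f (x + t • v) - f x)) (𝓝[≠] 0) (𝓝 z)

/-- `f` is a `C^∞_𝕜`-map in the sense of Bastiani: all iterated directional derivatives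
`D k (x, y_1, …, y_k) = (D_{y_k} ⋯ D_{y_1} f)(x)` exist and are jointly continuous. -/
def IsSmooth (f : E → F) : Prop :=
  ∃ D : (k : ℕ) → E → (Fin k → E) → F,
    (∀ x y, D 0 x y = f x) ∧
    (∀ k x (y : Fin k → E) v,
      HasDirDerivAt 𝕜 (fun x' => D k x' y) x v (D (k + 1) x (Fin.snoc y v))) ∧
    ∀ k, Continuous fun p : E × (Fin k → E) => D k p.1 p.2

end Calculus

/-! ### Lie groups with a global chart and their Lie algebras

`G` is a manifold modelled on `E` with the single chart `φ : G ≃ E`. All its tangent spaces are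
identified with `E` through `φ`, so a vector field is a map `G → E`. -/

section LieGroup

variable (𝕜 : Type*) [RCLike 𝕜] {G E : Type*} [Group G]
  [AddCommGroup E] [Module 𝕜 E] [TopologicalSpace E] (φ : G ≃ E)

/-- Multiplication and inversion of `G` are `C^∞_𝕜`-maps. -/
structure IsLieGroup : Prop where
  smooth_mul : IsSmooth 𝕜 fun p : E × E => φ (φ.symm p.1 * φ.symm p.2)
  smooth_inv : IsSmooth 𝕜 fun x : E => φ (φ.symm x)⁻¹

/-- `V` is a smooth left invariant vector field: `T λ_g (V h) = V (g h)` for all `g` and `h`, where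
`λ_g` is left multiplication by `g`. -/
structure IsLeftInvariant (V : G → E) : Prop where
  smooth : IsSmooth 𝕜 fun x : E => V (φ.symm x)
  invariant : ∀ g h : G,
    HasDirDerivAt 𝕜 (fun x : E => φ (g * φ.symm x)) (φ h) (V h) (V (g * h))

/-- The vector field `Z` is the Lie bracket `[V, W] = dW(V) - dV(W)` of vector fields. -/
def IsFieldBracket (V W Z : G → E) : Prop :=
  ∀ g : G, ∃ a b : E,
    HasDirDerivAt 𝕜 (fun x : E => W (φ.symm x)) (φ g) (V g) a ∧
    HasDirDerivAt 𝕜 (fun x : E => V (φ.symm x)) (φ g) (W g) b ∧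
    Z g = a - b

/-- `E`, as the tangent space at the unit, with the bracket `br` is the Lie algebra of `G`: it is
a Lie algebra, and evaluation at the unit is an isomorphism onto it from the left invariant
vector fields with their Lie bracket. -/
structure IsLieAlgebraOf (br : E → E → E) : Prop where
  add_left : ∀ u v w, br (u + v) w = br u w + br v w
  smul_left : ∀ (t : 𝕜) u v, br (t • u) v = t • br u v
  add_right : ∀ u v w, br u (v + w) = br u v + br u w
  smul_right : ∀ (t : 𝕜) u v, br u (t • v) = t • br u v
  self : ∀ u, br u u = 0
  jacobi : ∀ u v w, br u (br v w) + br v (br w u) + br w (br u v) = 0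
  existsUnique_field : ∀ v : E, ∃! V : G → E, IsLeftInvariant 𝕜 φ V ∧ V 1 = v
  field_bracket : ∀ V W : G → E, IsLeftInvariant 𝕜 φ V → IsLeftInvariant 𝕜 φ W →
    ∃ Z : G → E, IsLeftInvariant 𝕜 φ Z ∧ IsFieldBracket 𝕜 φ V W Z ∧ Z 1 = br (V 1) (W 1)

end LieGroup

end ChenFliess

open ChenFliess

namespace ChenFliess

/-! ### Finite sums over words -/

/-! A series is determined by its constant coefficient and its shifts `∂_j e`, and `∂_j` is a
derivation of the shuffle product. Splitting words by their first letter turns both products into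
recursions, writing `e ∘ d` for mixed composition with `δ + d`: `∂_j (e ∘ d) = (∂_j e) ∘ d + [j = 0]
∑_i d[i] ⧢ ((∂_i e) ∘ d)` and `∂_j (e ◁ d) = (∂_j e) ◁ d + [j = 0] ∑_i d[i] ⧢ ∂_i e`.

Induction on word length then gives the algebra: `e ↦ e ∘ d` respects shuffles
(`scalarComp_shuffle`), hence associativity (`scalarComp_scalarComp`); `e ↦ e ◁ d` is a derivation
of the shuffle product (`scalarPreLie_shuffle`), hence the pre-Lie identity
(`scalarPreLie_associator_symm`). Inverses are fixed points of a map that is contracting for word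
length (`scalarComp_congr`).

Each coefficient of the product and of the inverse is a polynomial in coefficients of the arguments,
and polynomial functions are closed under directional derivatives, hence smoothness.

The left invariant field with value `v` at `δ` is `g ↦ v + g ◁ v`: along a curve with velocity `v +
c ◁ v`, the derivative of `e ∘ c` is `(e ∘ c) ◁ v` (`hasDerivAt_scalarComp`). These fields are
affine, and the pre-Lie identity puts their bracket into the same form. The derivative at `0` also
identifies `◁` as the linear part of the product. -/

theorem finsum_eq_finsum_comp_of_injective {α β M : Type*} [AddCommMonoid M] {g : α → β}
    (hg : Function.Injective g) {f : β → M} (hf : ∀ b, f b ≠ 0 → b ∈ Set.range g) :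
    ∑ᶠ b, f b = ∑ᶠ a, f (g a) := by
  rw [← finsum_mem_range hg, ← finsum_mem_univ]
  exact finsum_mem_inter_support_eq' _ _ _ fun x hx => by simpa using hf x hx

/-- The words over `x_0, …, x_m` are the empty word and the words `x_i η`. -/
def optionEquivWord (m : ℕ) : Option (Fin (m + 1) × Word m) ≃ Word m where
  toFun p := p.elim [] fun q => q.1 :: q.2
  invFun
    | [] => none
    | i :: η => some (i, η)
  left_inv p := by cases p <;> rfl
  right_inv η := by cases η <;> rfl

theorem finsum_word {m : ℕ} {M : Type*} [AddCommMonoid M] {f : Word m → M}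
    (hf : (Function.support f).Finite) :
    ∑ᶠ η, f η = f [] + ∑ i, ∑ᶠ η : Word m, f (i :: η) := by
  have hf' : (Function.support fun p => f (optionEquivWord m p)).Finite :=
    hf.preimage (optionEquivWord m).injective.injOn
  rw [← finsum_comp_equiv (optionEquivWord m), finsum_option, finsum_curry,
    finsum_eq_sum_of_fintype]
  · rfl
  · exact hf'.preimage (Option.some_injective _).injOn
  · exact hf'.preimage (Option.some_injective _).injOn

/-- The series `∂_i e` with `(∂_i e, η) = (e, x_i η)`. -/
def shift {𝕜 : Type*} {m : ℕ} (i : Fin (m + 1)) (e : ScalarSeries 𝕜 m) : ScalarSeries 𝕜 m := fun η => e (i :: η)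

theorem shift_apply {𝕜 : Type*} {m : ℕ} (i : Fin (m + 1)) (e : ScalarSeries 𝕜 m) (η : Word m) :
    shift i e η = e (i :: η) := rfl

noncomputable section

variable {𝕜 : Type*} [RCLike 𝕜] {m : ℕ}

theorem prepend_cons (i j : Fin (m + 1)) (e : ScalarSeries 𝕜 m) (η : Word m) :
    prepend i e (j :: η) = if j = i then e η else 0 := rfl

theorem shift_add (i : Fin (m + 1)) (e f : ScalarSeries 𝕜 m) :
    shift i (e + f) = shift i e + shift i f := rfl

theorem shift_smul (i : Fin (m + 1)) (a : 𝕜) (e : ScalarSeries 𝕜 m) :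
    shift i (a • e) = a • shift i e := rfl

/-! ### The shuffle algebra -/

theorem wordShuffle_nil_left (ξ : Word m) : (wordShuffle [] ξ : ScalarSeries 𝕜 m) = word ξ := by
  rw [wordShuffle]

theorem wordShuffle_nil_right (η : Word m) : (wordShuffle η [] : ScalarSeries 𝕜 m) = word η := by
  cases η <;> rw [wordShuffle]

/-- The first letter of a shuffle is the first letter of one of the two factors. Using `head?` and
`tail` covers empty factors by the same formula. -/
theorem wordShuffle_apply_cons (η ξ ζ : Word m) (j : Fin (m + 1)) :
    (wordShuffle η ξ (j :: ζ) : 𝕜) =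
      (if η.head? = some j then wordShuffle η.tail ξ ζ else 0) +
      (if ξ.head? = some j then wordShuffle η ξ.tail ζ else 0) := by
  rcases η with _ | ⟨i, η⟩ <;> rcases ξ with _ | ⟨k, ξ⟩
  · simp [wordShuffle_nil_left, word]
  · simp [wordShuffle_nil_left, word, ite_and, eq_comm]
  · simp [wordShuffle_nil_right, word, ite_and, eq_comm]
  · rw [wordShuffle]
    simp [prepend_cons, eq_comm]

theorem shuffle_apply_nil (c d : ScalarSeries 𝕜 m) : shuffle c d [] = c [] * d [] := by
  rw [shuffle, finsum_eq_single _ ([], [])]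
  · simp [wordShuffle_nil_left, word]
  · rintro ⟨η, ξ⟩ hne
    by_contra h
    have : 0 = η.length + ξ.length :=
      length_of_wordShuffle_ne_zero _ _ _ (right_ne_zero_of_mul h)
    have hη : η = [] := List.length_eq_zero_iff.1 (by omega)
    have hξ : ξ = [] := List.length_eq_zero_iff.1 (by omega)
    exact hne (by rw [hη, hξ])

/-- This is the derivation property of the shift. The double sum splits according to which factor
supplies the letter `j`, and each half is reindexed by removing that letter. -/
theorem shuffle_apply_cons (c d : ScalarSeries 𝕜 m) (j : Fin (m + 1)) (ζ : Word m) :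
    shuffle c d (j :: ζ) = shuffle (shift j c) d ζ + shuffle c (shift j d) ζ := by
  have e1 : shuffle (shift j c) d ζ = ∑ᶠ p : Word m × Word m, c p.1 * d p.2 *
      (if p.1.head? = some j then wordShuffle p.1.tail p.2 ζ else 0) := by
    rw [finsum_eq_finsum_comp_of_injective (g := fun p : Word m × Word m => (j :: p.1, p.2))]
    · simp [shuffle, shift]
    · rintro ⟨a, b⟩ ⟨a', b'⟩ h
      simpa using h
    · rintro ⟨_ | ⟨i, η⟩, ξ⟩ h
      · simp at h
      · have : i = j := by
          by_contra hne
          simp [hne] at h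
        exact ⟨(η, ξ), by simp [this]⟩
  have e2 : shuffle c (shift j d) ζ = ∑ᶠ p : Word m × Word m, c p.1 * d p.2 *
      (if p.2.head? = some j then wordShuffle p.1 p.2.tail ζ else 0) := by
    rw [finsum_eq_finsum_comp_of_injective (g := fun p : Word m × Word m => (p.1, j :: p.2))]
    · simp [shuffle, shift]
    · rintro ⟨a, b⟩ ⟨a', b'⟩ h
      simpa using h
    · rintro ⟨ξ, _ | ⟨i, η⟩⟩ h
      · simp at h
      · have : i = j := by
          by_contra hne
          simp [hne] at h
        exact ⟨(ξ, η), by simp [this]⟩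
  have bound : {p : Word m × Word m |
      p.1.length ≤ ζ.length + 1 ∧ p.2.length ≤ ζ.length + 1}.Finite :=
    (List.finite_length_le (Fin (m + 1)) (ζ.length + 1)).prod
      (List.finite_length_le (Fin (m + 1)) (ζ.length + 1))
  rw [e1, e2, ← finsum_add_distrib]
  · simp only [shuffle, wordShuffle_apply_cons, mul_add]
  · refine bound.subset fun p hp => ?_
    rcases p with ⟨_ | ⟨i, η⟩, ξ⟩
    · simp at hp
    · have h := right_ne_zero_of_mul hp
      have := length_of_wordShuffle_ne_zero _ _ _ (ite_ne_right_iff.1 h).2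
      simp at this ⊢
      omega
  · refine bound.subset fun p hp => ?_
    rcases p with ⟨ξ, _ | ⟨i, η⟩⟩
    · simp at hp
    · have h := right_ne_zero_of_mul hp
      have := length_of_wordShuffle_ne_zero _ _ _ (ite_ne_right_iff.1 h).2
      simp at this ⊢
      omega

theorem shift_shuffle (j : Fin (m + 1)) (c d : ScalarSeries 𝕜 m) :
    shift j (shuffle c d) = shuffle (shift j c) d + shuffle c (shift j d) :=
  funext fun ζ => shuffle_apply_cons c d j ζ

/-- The series are generalized in this and the following inductions because the recursion replaces
them by their shifts. -/
theorem shuffle_comm (c d : ScalarSeries 𝕜 m) : shuffle c d = shuffle d c := by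
  ext ν
  induction ν generalizing c d with
  | nil => rw [shuffle_apply_nil, shuffle_apply_nil, mul_comm]
  | cons j ζ ih =>
    rw [shuffle_apply_cons, shuffle_apply_cons, ih (shift j c), ih c, add_comm]

theorem add_shuffle (a b c : ScalarSeries 𝕜 m) :
    shuffle (a + b) c = shuffle a c + shuffle b c := by
  ext ν
  induction ν generalizing a b c with
  | nil => simp [shuffle_apply_nil, add_mul]
  | cons j ζ ih =>
    simp only [Pi.add_apply, shuffle_apply_cons, shift_add, ih]
    ring

theorem shuffle_add (a b c : ScalarSeries 𝕜 m) :
    shuffle a (b + c) = shuffle a b + shuffle a c := by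
  rw [shuffle_comm, add_shuffle, shuffle_comm b, shuffle_comm c]

theorem smul_shuffle (t : 𝕜) (a b : ScalarSeries 𝕜 m) :
    shuffle (t • a) b = t • shuffle a b := by
  ext ν
  induction ν generalizing a b with
  | nil => simp [shuffle_apply_nil, mul_assoc]
  | cons j ζ ih =>
    simp only [Pi.smul_apply, shuffle_apply_cons, shift_smul, ih, smul_add]

theorem shuffle_smul (t : 𝕜) (a b : ScalarSeries 𝕜 m) :
    shuffle a (t • b) = t • shuffle a b := by
  rw [shuffle_comm, smul_shuffle, shuffle_comm]

/-- The shuffle product as a bilinear map. -/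
def shuffleₗ : ScalarSeries 𝕜 m →ₗ[𝕜] ScalarSeries 𝕜 m →ₗ[𝕜] ScalarSeries 𝕜 m :=
  LinearMap.mk₂ 𝕜 shuffle add_shuffle smul_shuffle shuffle_add shuffle_smul

theorem zero_shuffle (b : ScalarSeries 𝕜 m) : shuffle 0 b = 0 := shuffleₗ.map_zero₂ b

theorem shuffle_zero (a : ScalarSeries 𝕜 m) : shuffle a 0 = 0 := (shuffleₗ a).map_zero

theorem sum_shuffle {ι : Type*} (s : Finset ι) (a : ι → ScalarSeries 𝕜 m)
    (b : ScalarSeries 𝕜 m) : shuffle (∑ i ∈ s, a i) b = ∑ i ∈ s, shuffle (a i) b :=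
  LinearMap.map_sum₂ shuffleₗ s a b

theorem shuffle_sum {ι : Type*} (s : Finset ι) (a : ScalarSeries 𝕜 m)
    (b : ι → ScalarSeries 𝕜 m) : shuffle a (∑ i ∈ s, b i) = ∑ i ∈ s, shuffle a (b i) :=
  map_sum (shuffleₗ a) b s

theorem shuffle_assoc (a b c : ScalarSeries 𝕜 m) :
    shuffle (shuffle a b) c = shuffle a (shuffle b c) := by
  ext ν
  induction ν generalizing a b c with
  | nil => simp [shuffle_apply_nil, mul_assoc]
  | cons j ζ ih =>
    simp only [shuffle_apply_cons, shift_shuffle, add_shuffle, shuffle_add, Pi.add_apply, ih]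
    ring

theorem shuffle_left_comm (a b c : ScalarSeries 𝕜 m) :
    shuffle a (shuffle b c) = shuffle b (shuffle a c) := by
  rw [← shuffle_assoc, shuffle_comm a b, shuffle_assoc]

/-- A coefficient of `a ⧢ b` depends only on coefficients of at most the same length. -/
theorem shuffle_congr {a a' b b' : ScalarSeries 𝕜 m} {ν : Word m}
    (ha : ∀ ξ : Word m, ξ.length ≤ ν.length → a ξ = a' ξ)
    (hb : ∀ ξ : Word m, ξ.length ≤ ν.length → b ξ = b' ξ) :
    shuffle a b ν = shuffle a' b' ν := by
  induction ν generalizing a a' b b' with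
  | nil => rw [shuffle_apply_nil, shuffle_apply_nil, ha [] le_rfl, hb [] le_rfl]
  | cons j ζ ih =>
    rw [shuffle_apply_cons, shuffle_apply_cons]
    congr 1
    · exact ih (fun ξ hξ => ha _ (by simpa using hξ)) fun ξ hξ => hb _ (by simp; omega)
    · exact ih (fun ξ hξ => ha _ (by simp; omega)) fun ξ hξ => hb _ (by simpa using hξ)

/-- Shuffling commutes with locally finite sums. Finiteness is proved in the same induction, since
splitting the sum in the inductive step needs it. -/
theorem shuffle_finsum_smul (a : ScalarSeries 𝕜 m) {ι : Type*} (e : ι → 𝕜)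
    (W : ι → ScalarSeries 𝕜 m) (hW : ∀ ν, (Function.support fun η => W η ν).Finite)
    (ζ : Word m) :
    shuffle a (fun ν => ∑ᶠ η, W η ν * e η) ζ = ∑ᶠ η, shuffle a (W η) ζ * e η ∧
      (Function.support fun η => shuffle a (W η) ζ).Finite := by
  induction ζ generalizing a W with
  | nil =>
    constructor
    · rw [shuffle_apply_nil, mul_finsum']
      · simp only [shuffle_apply_nil, mul_assoc]
      · exact (hW []).subset fun η h => left_ne_zero_of_mul h
    · refine (hW []).subset fun η h => ?_
      rw [Function.mem_support, shuffle_apply_nil] at h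
      exact right_ne_zero_of_mul h
  | cons j ζ ih =>
    have h1 := ih (shift j a) W hW
    have h2 := ih a (fun η => shift j (W η)) fun ν => hW (j :: ν)
    constructor
    · simp only [shuffle_apply_cons, add_mul]
      rw [finsum_add_distrib, ← h1.1, ← h2.1]
      · rfl
      · exact h1.2.subset fun η h => left_ne_zero_of_mul h
      · exact h2.2.subset fun η h => left_ne_zero_of_mul h
    · simp only [shuffle_apply_cons]
      exact (h1.2.union h2.2).subset (Function.support_add _ _)

end


/-- The series of `i`-th coordinates. -/
def coord {𝕜 : Type*} {m : ℕ} (c : Series 𝕜 m) (i : Fin m) : ScalarSeries 𝕜 m := fun η => c η i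

theorem series_ext {𝕜 : Type*} {m : ℕ} {c d : Series 𝕜 m} (h : ∀ i, coord c i = coord d i) : c = d :=
  funext fun η => funext fun i => congrFun (h i) η

noncomputable section

variable {𝕜 : Type*} [RCLike 𝕜] {m : ℕ}

/-! ### Scalar mixed composition and pre-Lie product -/

theorem finite_support_mul_of_length_le {W : Word m → ScalarSeries 𝕜 m}
    (hW : ∀ η ν, W η ν ≠ 0 → η.length ≤ ν.length) (e : ScalarSeries 𝕜 m) (ν : Word m) :
    (Function.support fun η => W η ν * e η).Finite :=
  (List.finite_length_le (Fin (m + 1)) ν.length).subset fun η hη =>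
    hW η ν (left_ne_zero_of_mul hη)

theorem finite_support_of_length_le {W : Word m → ScalarSeries 𝕜 m}
    (hW : ∀ η ν, W η ν ≠ 0 → η.length ≤ ν.length) (ν : Word m) :
    (Function.support fun η => W η ν).Finite :=
  (List.finite_length_le (Fin (m + 1)) ν.length).subset fun η hη => hW η ν hη

/-- The mixed composition `∑_η (e, η) φ_d(η)(1)` of a scalar series `e` with `δ + d`. -/
def scalarComp (d : Series 𝕜 m) (e : ScalarSeries 𝕜 m) : ScalarSeries 𝕜 m := fun ν =>
  ∑ᶠ η : Word m, wordMixedComp d η ν * e η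

/-- The pre-Lie product `∑_η (e, η) (η ◁ d)` of a scalar series `e` with `d`. -/
def scalarPreLie (d : Series 𝕜 m) (e : ScalarSeries 𝕜 m) : ScalarSeries 𝕜 m := fun ν =>
  ∑ᶠ η : Word m, wordPreLie d η ν * e η

theorem coord_add (c d : Series 𝕜 m) (i : Fin m) : coord (c + d) i = coord c i + coord d i := rfl

theorem coord_smul (t : 𝕜) (c : Series 𝕜 m) (i : Fin m) : coord (t • c) i = t • coord c i := rfl

theorem component_zero (d : Series 𝕜 m) : component d 0 = 0 := rfl

theorem component_succ (d : Series 𝕜 m) (i : Fin m) : component d i.succ = coord d i := rfl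

theorem component_add (c d : Series 𝕜 m) (i : Fin (m + 1)) :
    component (c + d) i = component c i + component d i := by
  cases i using Fin.cases
  · simp [component_zero]
  · rfl

theorem component_smul (t : 𝕜) (d : Series 𝕜 m) (i : Fin (m + 1)) :
    component (t • d) i = t • component d i := by
  cases i using Fin.cases
  · simp [component_zero]
  · rfl

theorem coord_mixedComp (c d : Series 𝕜 m) (i : Fin m) :
    coord (mixedComp c d) i = scalarComp d (coord c i) := by
  ext ν
  exact (Pi.evalAddMonoidHom (fun _ : Fin m => 𝕜) i).map_finsum (finite_support_mixedComp c d ν)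

theorem coord_preLie (c d : Series 𝕜 m) (i : Fin m) :
    coord (preLie c d) i = scalarPreLie d (coord c i) := by
  ext ν
  exact (Pi.evalAddMonoidHom (fun _ : Fin m => 𝕜) i).map_finsum (finite_support_preLie c d ν)

theorem wordMixedComp_apply_nil (d : Series 𝕜 m) (η : Word m) (h : η ≠ []) :
    wordMixedComp d η [] = 0 := by
  by_contra h'
  have := length_le_of_wordMixedComp_ne_zero d η [] h'
  exact h (List.length_eq_zero_iff.1 (by simpa using this))

theorem scalarComp_apply_nil (d : Series 𝕜 m) (e : ScalarSeries 𝕜 m) :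
    scalarComp d e [] = e [] := by
  rw [scalarComp, finsum_eq_single _ []]
  · simp [wordMixedComp, word]
  · intro η h
    simp [wordMixedComp_apply_nil d η h]

/-- Words are split by their first letter and `φ_d(x_i)` is applied once; local finiteness moves the
shuffle with `d[i]` outside the sum. -/
theorem scalarComp_apply_cons (d : Series 𝕜 m) (e : ScalarSeries 𝕜 m) (j : Fin (m + 1))
    (ζ : Word m) : scalarComp d e (j :: ζ) = scalarComp d (shift j e) ζ +
      if j = 0 then ∑ i, shuffle (component d i) (scalarComp d (shift i e)) ζ else 0 := by
  have hl := length_le_of_wordMixedComp_ne_zero d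
  have hs := fun i => shuffle_finsum_smul (component d i) (shift i e) (wordMixedComp d)
    (finite_support_of_length_le hl) ζ
  have key : ∀ i, ∑ᶠ η : Word m, wordMixedComp d (i :: η) (j :: ζ) * e (i :: η) =
      (if j = i then scalarComp d (shift i e) ζ else 0) +
      if j = 0 then shuffle (component d i) (scalarComp d (shift i e)) ζ else 0 := by
    intro i
    simp only [wordMixedComp, Pi.add_apply, prepend_cons, add_mul]
    rw [finsum_add_distrib]
    · congr 1
      · split_ifs
        · rfl
        · simp
      · split_ifs
        · exact (hs i).1.symm
        · simp
    · split_ifs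
      · exact finite_support_mul_of_length_le hl (shift i e) ζ
      · simp [Function.HasFiniteSupport]
    · split_ifs
      · exact (hs i).2.subset fun η h => left_ne_zero_of_mul h
      · simp [Function.HasFiniteSupport]
  rw [scalarComp, finsum_word (finite_support_mul_of_length_le hl e _)]
  simp only [key, Finset.sum_add_distrib, Finset.sum_ite_eq, Finset.mem_univ, if_true]
  -- The empty word contributes only to the constant coefficient.
  rw [wordMixedComp, word, if_neg (by simp), zero_mul, zero_add]
  split_ifs
  · rfl
  · simp

theorem finsum_word_mul (e : ScalarSeries 𝕜 m) (ν : Word m) :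
    ∑ᶠ η : Word m, word η ν * e η = e ν := by
  rw [finsum_eq_single _ ν]
  · simp [word]
  · intro η h
    simp [word, h.symm]

theorem scalarPreLie_apply_nil (d : Series 𝕜 m) (e : ScalarSeries 𝕜 m) :
    scalarPreLie d e [] = 0 := by
  have (η : Word m) : wordPreLie d η [] = 0 := by cases η <;> simp [wordPreLie, prepend]
  simp [scalarPreLie, this]

theorem scalarPreLie_apply_cons (d : Series 𝕜 m) (e : ScalarSeries 𝕜 m) (j : Fin (m + 1))
    (ζ : Word m) : scalarPreLie d e (j :: ζ) = scalarPreLie d (shift j e) ζ +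
      if j = 0 then ∑ i, shuffle (component d i) (shift i e) ζ else 0 := by
  have hl := length_le_of_wordPreLie_ne_zero d
  have hw : ∀ η ν : Word m, (word η ν : 𝕜) ≠ 0 → η.length ≤ ν.length := by
    intro η ν h
    rw [word, ite_ne_right_iff] at h
    rw [h.1]
  have hs := fun i => shuffle_finsum_smul (component d i) (shift i e) word
    (finite_support_of_length_le hw) ζ
  -- Here the inner factor is the word itself, so the locally finite sum is just `shift i e`: unlike
  -- in mixed composition, the recursion does not re-enter the shuffle.
  simp only [finsum_word_mul] at hs
  have key : ∀ i, ∑ᶠ η : Word m, wordPreLie d (i :: η) (j :: ζ) * e (i :: η) =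
      (if j = i then scalarPreLie d (shift i e) ζ else 0) +
      if j = 0 then shuffle (component d i) (shift i e) ζ else 0 := by
    intro i
    simp only [wordPreLie, Pi.add_apply, prepend_cons, add_mul, shuffle_comm _ (component d i)]
    rw [finsum_add_distrib]
    · congr 1
      · split_ifs
        · rfl
        · simp
      · split_ifs
        · exact (hs i).1.symm
        · simp
    · split_ifs
      · exact finite_support_mul_of_length_le hl (shift i e) ζ
      · simp [Function.HasFiniteSupport]
    · split_ifs
      · exact (hs i).2.subset fun η h => left_ne_zero_of_mul h
      · simp [Function.HasFiniteSupport]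
  rw [scalarPreLie, finsum_word (finite_support_mul_of_length_le hl e _)]
  simp only [key, Finset.sum_add_distrib, Finset.sum_ite_eq, Finset.mem_univ, if_true]
  rw [wordPreLie, Pi.zero_apply, zero_mul, zero_add]
  split_ifs
  · rfl
  · simp

/-! ### Linearity -/

theorem scalarComp_add (d : Series 𝕜 m) (e f : ScalarSeries 𝕜 m) :
    scalarComp d (e + f) = scalarComp d e + scalarComp d f := by
  have hl := length_le_of_wordMixedComp_ne_zero d
  ext ν
  simp only [scalarComp, Pi.add_apply, mul_add]
  exact finsum_add_distrib (finite_support_mul_of_length_le hl e ν)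
    (finite_support_mul_of_length_le hl f ν)

theorem scalarComp_smul (d : Series 𝕜 m) (t : 𝕜) (e : ScalarSeries 𝕜 m) :
    scalarComp d (t • e) = t • scalarComp d e := by
  ext ν
  simp only [scalarComp, Pi.smul_apply, smul_eq_mul, mul_finsum, mul_left_comm]

theorem scalarPreLie_add (d : Series 𝕜 m) (e f : ScalarSeries 𝕜 m) :
    scalarPreLie d (e + f) = scalarPreLie d e + scalarPreLie d f := by
  have hl := length_le_of_wordPreLie_ne_zero d
  ext ν
  simp only [scalarPreLie, Pi.add_apply, mul_add]
  exact finsum_add_distrib (finite_support_mul_of_length_le hl e ν)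
    (finite_support_mul_of_length_le hl f ν)

theorem scalarPreLie_smul (d : Series 𝕜 m) (t : 𝕜) (e : ScalarSeries 𝕜 m) :
    scalarPreLie d (t • e) = t • scalarPreLie d e := by
  ext ν
  simp only [scalarPreLie, Pi.smul_apply, smul_eq_mul, mul_finsum, mul_left_comm]

/-- Mixed composition with `δ + d` as a linear map. -/
def scalarCompₗ (d : Series 𝕜 m) : ScalarSeries 𝕜 m →ₗ[𝕜] ScalarSeries 𝕜 m where
  toFun := scalarComp d
  map_add' := scalarComp_add d
  map_smul' := scalarComp_smul d

/-- Right pre-Lie multiplication by `d` as a linear map. -/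
def scalarPreLieₗ (d : Series 𝕜 m) : ScalarSeries 𝕜 m →ₗ[𝕜] ScalarSeries 𝕜 m where
  toFun := scalarPreLie d
  map_add' := scalarPreLie_add d
  map_smul' := scalarPreLie_smul d

theorem scalarComp_sum {ι : Type*} (d : Series 𝕜 m) (s : Finset ι) (e : ι → ScalarSeries 𝕜 m) :
    scalarComp d (∑ i ∈ s, e i) = ∑ i ∈ s, scalarComp d (e i) :=
  map_sum (scalarCompₗ d) e s

theorem scalarPreLie_sum {ι : Type*} (d : Series 𝕜 m) (s : Finset ι)
    (e : ι → ScalarSeries 𝕜 m) :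
    scalarPreLie d (∑ i ∈ s, e i) = ∑ i ∈ s, scalarPreLie d (e i) :=
  map_sum (scalarPreLieₗ d) e s

theorem scalarComp_zero (d : Series 𝕜 m) : scalarComp d 0 = 0 := (scalarCompₗ d).map_zero

theorem scalarPreLie_zero (d : Series 𝕜 m) : scalarPreLie d 0 = 0 := (scalarPreLieₗ d).map_zero

/-- The recursion for `◁` is affine in the unknown and its inhomogeneous term is linear in `d`, so
linearity in `d` propagates. -/
theorem scalarPreLie_add_left (c d : Series 𝕜 m) (e : ScalarSeries 𝕜 m) :
    scalarPreLie (c + d) e = scalarPreLie c e + scalarPreLie d e := by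
  ext ν
  induction ν generalizing e with
  | nil => simp [scalarPreLie_apply_nil]
  | cons j ζ ih =>
    simp only [Pi.add_apply, scalarPreLie_apply_cons, ih, component_add, add_shuffle,
      Finset.sum_add_distrib]
    split_ifs <;> ring

theorem scalarPreLie_smul_left (t : 𝕜) (d : Series 𝕜 m) (e : ScalarSeries 𝕜 m) :
    scalarPreLie (t • d) e = t • scalarPreLie d e := by
  ext ν
  induction ν generalizing e with
  | nil => simp [scalarPreLie_apply_nil]
  | cons j ζ ih =>
    simp only [Pi.smul_apply, scalarPreLie_apply_cons, ih, component_smul, smul_shuffle,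
      ← Finset.smul_sum]
    split_ifs <;> simp [mul_add]

theorem preLie_add_left (a b d : Series 𝕜 m) : preLie (a + b) d = preLie a d + preLie b d :=
  series_ext fun i => by
    simp only [coord_add, coord_preLie, scalarPreLie_add]

theorem preLie_smul_left (t : 𝕜) (a d : Series 𝕜 m) : preLie (t • a) d = t • preLie a d :=
  series_ext fun i => by
    simp only [coord_smul, coord_preLie, scalarPreLie_smul]

theorem preLie_add_right (a b d : Series 𝕜 m) : preLie a (b + d) = preLie a b + preLie a d :=
  series_ext fun i => by
    simp only [coord_add, coord_preLie, scalarPreLie_add_left]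

theorem preLie_smul_right (t : 𝕜) (a d : Series 𝕜 m) : preLie a (t • d) = t • preLie a d :=
  series_ext fun i => by
    simp only [coord_smul, coord_preLie, scalarPreLie_smul_left]

theorem isLinearMap_preLie_left (d : Series 𝕜 m) : IsLinearMap 𝕜 fun c => preLie c d :=
  ⟨fun a b => preLie_add_left a b d, fun t a => preLie_smul_left t a d⟩

theorem isLinearMap_preLie_right (c : Series 𝕜 m) : IsLinearMap 𝕜 fun d => preLie c d :=
  ⟨fun a b => preLie_add_right c a b, fun t a => preLie_smul_right t c a⟩

theorem isLinearMap_mixedComp (d : Series 𝕜 m) : IsLinearMap 𝕜 fun c => mixedComp c d where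
  map_add a b := series_ext fun i => by
    simp only [coord_add, coord_mixedComp, scalarComp_add]
  map_smul t a := series_ext fun i => by
    simp only [coord_smul, coord_mixedComp, scalarComp_smul]

/-! ### Mixed composition is multiplicative, and the associative law -/

theorem shift_scalarComp (d : Series 𝕜 m) (e : ScalarSeries 𝕜 m) (j : Fin (m + 1)) :
    shift j (scalarComp d e) = scalarComp d (shift j e) +
      if j = 0 then ∑ i, shuffle (component d i) (scalarComp d (shift i e)) else 0 := by
  ext ζ
  rw [shift_apply, scalarComp_apply_cons]
  split_ifs <;> simp

theorem shift_scalarPreLie (d : Series 𝕜 m) (e : ScalarSeries 𝕜 m) (j : Fin (m + 1)) :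
    shift j (scalarPreLie d e) = scalarPreLie d (shift j e) +
      if j = 0 then ∑ i, shuffle (component d i) (shift i e) else 0 := by
  ext ζ
  rw [shift_apply, scalarPreLie_apply_cons]
  split_ifs <;> simp

theorem scalarComp_shuffle (d : Series 𝕜 m) (e f : ScalarSeries 𝕜 m) :
    scalarComp d (shuffle e f) = shuffle (scalarComp d e) (scalarComp d f) := by
  -- The recursion shuffles the unknown with `d[i]`, so the hypothesis is needed at all words of
  -- length at most that of the tail, not only at the tail.
  suffices H : ∀ (n : ℕ) (ν : Word m), ν.length ≤ n → ∀ e f : ScalarSeries 𝕜 m,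
      scalarComp d (shuffle e f) ν = shuffle (scalarComp d e) (scalarComp d f) ν from
    funext fun ν => H _ ν le_rfl e f
  intro n
  induction n with
  | zero =>
    intro ν hν e f
    rw [List.length_eq_zero_iff.1 (Nat.le_zero.1 hν)]
    simp only [scalarComp_apply_nil, shuffle_apply_nil]
  | succ n ih =>
    rintro (_ | ⟨j, ζ⟩) hν e f
    · simp only [scalarComp_apply_nil, shuffle_apply_nil]
    have hζ : ζ.length ≤ n := by simpa using hν
    have h (i : Fin (m + 1)) : shuffle (component d i) (scalarComp d (shift i (shuffle e f))) ζ =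
        shuffle (component d i) (shuffle (scalarComp d (shift i e)) (scalarComp d f) +
          shuffle (scalarComp d e) (scalarComp d (shift i f))) ζ := by
      refine shuffle_congr (fun _ _ => rfl) fun ξ hξ => ?_
      rw [shift_shuffle, scalarComp_add, Pi.add_apply, Pi.add_apply, ih ξ (hξ.trans hζ),
        ih ξ (hξ.trans hζ)]
    rw [scalarComp_apply_cons, shuffle_apply_cons, shift_scalarComp, shift_scalarComp]
    simp only [h]
    rw [shift_shuffle, scalarComp_add, Pi.add_apply, ih ζ hζ, ih ζ hζ, add_shuffle, shuffle_add]
    split_ifs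
    · simp only [shuffle_add, sum_shuffle, shuffle_sum, shuffle_assoc, Pi.add_apply,
        Finset.sum_apply, Finset.sum_add_distrib, shuffle_left_comm (scalarComp d e)]
      ring
    · simp [shuffle_zero, zero_shuffle]

theorem component_add_mixedComp (b d : Series 𝕜 m) (i : Fin (m + 1)) :
    component (d + mixedComp b d) i = component d i + scalarComp d (component b i) := by
  cases i using Fin.cases with
  | zero => simp [component_zero, scalarComp_zero]
  | succ i => rw [component_add, component_succ, component_succ, coord_mixedComp, component_succ]

theorem component_preLie (a b : Series 𝕜 m) (i : Fin (m + 1)) :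
    component (preLie a b) i = scalarPreLie b (component a i) := by
  cases i using Fin.cases with
  | zero => simp [component_zero, scalarPreLie_zero]
  | succ i => rw [component_succ, coord_preLie, component_succ]

/-- The `x_0`-correction in the shift of a product occurs only for `i = 0`, where the convention
`d[0] = 0` kills it. -/
theorem ite_shuffle_component (d : Series 𝕜 m) (i : Fin (m + 1)) (p : Prop) [Decidable p]
    (hp : p → i = 0) (f : ScalarSeries 𝕜 m) : shuffle (component d i) (if p then f else 0) = 0 := by
  split_ifs with h
  · rw [hp h, component_zero, zero_shuffle]
  · rw [shuffle_zero]

/-- Multiplicativity carries mixed composition with `δ + d` through `b[i] ⧢ _`. Both sides then have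
the correction with `d[i]` plus the composition of `b[i]`, which is the `i`-th component of the
product. -/
theorem scalarComp_scalarComp (b d : Series 𝕜 m) (e : ScalarSeries 𝕜 m) :
    scalarComp d (scalarComp b e) = scalarComp (d + mixedComp b d) e := by
  suffices H : ∀ (n : ℕ) (ν : Word m), ν.length ≤ n → ∀ e : ScalarSeries 𝕜 m,
      scalarComp d (scalarComp b e) ν = scalarComp (d + mixedComp b d) e ν from
    funext fun ν => H _ ν le_rfl e
  intro n
  induction n with
  | zero =>
    intro ν hν e
    rw [List.length_eq_zero_iff.1 (Nat.le_zero.1 hν)]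
    simp only [scalarComp_apply_nil]
  | succ n ih =>
    rintro (_ | ⟨j, ζ⟩) hν e
    · simp only [scalarComp_apply_nil]
    have hζ : ζ.length ≤ n := by simpa using hν
    have h (i : Fin (m + 1)) : shuffle (component (d + mixedComp b d) i)
          (scalarComp (d + mixedComp b d) (shift i e)) ζ =
        shuffle (component (d + mixedComp b d) i) (scalarComp d (scalarComp b (shift i e))) ζ :=
      shuffle_congr (fun _ _ => rfl) fun ξ hξ => (ih ξ (hξ.trans hζ) _).symm
    rw [scalarComp_apply_cons, scalarComp_apply_cons]
    rw [Finset.sum_congr rfl fun i _ => h i]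
    simp only [shift_scalarComp, scalarComp_add, shuffle_add, apply_ite (scalarComp d),
      scalarComp_zero, component_add_mixedComp, add_shuffle, Pi.add_apply, ih ζ hζ,
      ite_shuffle_component d _ (_ = 0) id]
    split_ifs
    · simp only [scalarComp_sum, scalarComp_shuffle, Finset.sum_add_distrib, Finset.sum_apply,
        Pi.zero_apply, Finset.sum_const_zero]
      ring
    · simp

theorem mixedComp_mixedComp (a b d : Series 𝕜 m) :
    mixedComp (mixedComp a b) d = mixedComp a (d + mixedComp b d) :=
  series_ext fun i => by
    rw [coord_mixedComp, coord_mixedComp, coord_mixedComp, scalarComp_scalarComp]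

theorem comp_assoc (a b d : UnitalSeries 𝕜 m) : (a.comp b).comp d = a.comp (b.comp d) := by
  simp only [UnitalSeries.comp, (isLinearMap_mixedComp d.toSeries).map_add, mixedComp_mixedComp,
    add_assoc]

theorem scalarComp_zero_left (e : ScalarSeries 𝕜 m) : scalarComp 0 e = e := by
  have h (i : Fin (m + 1)) : component (0 : Series 𝕜 m) i = 0 := by
    cases i using Fin.cases <;> rfl
  ext ν
  induction ν generalizing e with
  | nil => rw [scalarComp_apply_nil]
  | cons j ζ ih =>
    rw [scalarComp_apply_cons, ih]
    simp [h, zero_shuffle, shift]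

theorem mixedComp_zero_right (c : Series 𝕜 m) : mixedComp c 0 = c :=
  series_ext fun i => by rw [coord_mixedComp, scalarComp_zero_left]

theorem comp_delta (a : UnitalSeries 𝕜 m) : a.comp .delta = a := by
  simp [UnitalSeries.comp, UnitalSeries.delta, mixedComp_zero_right]

/-! ### Inverses -/

/-- A coefficient of the mixed composition of `e` with `δ + d` depends only on strictly shorter
coefficients of `d`. -/
theorem scalarComp_congr {n : ℕ} {d d' : Series 𝕜 m}
    (hd : ∀ ξ : Word m, ξ.length < n → d ξ = d' ξ) (ν : Word m) (hν : ν.length ≤ n)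
    (e : ScalarSeries 𝕜 m) : scalarComp d e ν = scalarComp d' e ν := by
  induction n generalizing ν e with
  | zero =>
    rw [List.length_eq_zero_iff.1 (Nat.le_zero.1 hν), scalarComp_apply_nil, scalarComp_apply_nil]
  | succ n ih =>
    rcases ν with _ | ⟨j, ζ⟩
    · rw [scalarComp_apply_nil, scalarComp_apply_nil]
    have hζ : ζ.length ≤ n := by simpa using hν
    have ih' := ih fun ξ hξ => hd ξ (by omega)
    rw [scalarComp_apply_cons, scalarComp_apply_cons, ih' ζ hζ]
    congr 2
    refine Finset.sum_congr rfl fun i _ => shuffle_congr (fun ξ hξ => ?_) fun ξ hξ =>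
      ih' ξ (hξ.trans hζ) _
    rw [component, component, hd ξ (by omega)]

theorem mixedComp_congr {d d' : Series 𝕜 m} (ν : Word m)
    (hd : ∀ ξ : Word m, ξ.length < ν.length → d ξ = d' ξ) (c : Series 𝕜 m) :
    mixedComp c d ν = mixedComp c d' ν := by
  ext i
  have h := scalarComp_congr hd ν le_rfl (coord c i)
  rwa [← coord_mixedComp, ← coord_mixedComp] at h

/-- Iterates of `d ↦ -(mixed composition of c with δ + d)`. -/
def invApprox (c : Series 𝕜 m) : ℕ → Series 𝕜 m
  | 0 => 0
  | n + 1 => -mixedComp c (invApprox c n)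

/-- Each iteration makes the coefficients of one further length final, because mixed composition
reads only strictly shorter coefficients of `d`. -/
theorem invApprox_succ_apply (c : Series 𝕜 m) (n : ℕ) (ν : Word m) (hν : ν.length < n) :
    invApprox c (n + 1) ν = invApprox c n ν := by
  induction n generalizing ν with
  | zero => omega
  | succ n ih =>
    rw [invApprox, Pi.neg_apply, mixedComp_congr ν fun ξ hξ => ih ξ (by omega)]
    rfl

theorem invApprox_apply (c : Series 𝕜 m) {n : ℕ} {ν : Word m} (hν : ν.length < n) :
    invApprox c n ν = invApprox c (ν.length + 1) ν := by
  induction n, hν using Nat.le_induction with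
  | base => rfl
  | succ n hn ih => rw [invApprox_succ_apply c n ν hn, ih]

/-- The inverse of `δ + c` is `δ + inv c`. -/
def inv (c : Series 𝕜 m) : Series 𝕜 m := fun ν => invApprox c (ν.length + 1) ν

theorem inv_add_mixedComp (c : Series 𝕜 m) : inv c + mixedComp c (inv c) = 0 := by
  ext1 ν
  -- Below the length of `ν`, `inv c` agrees with the iterate of index `ν.length`, and the next
  -- iterate defines `inv c` at `ν`.
  rw [Pi.add_apply, mixedComp_congr (d := inv c) ν fun ξ hξ => (invApprox_apply c hξ).symm,
    inv, invApprox]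
  simp

/-- The group structure on `δ + 𝕜^m⟨⟨X⟩⟩`. -/
@[reducible] def unitalSeriesGroup (𝕜 : Type*) [RCLike 𝕜] (m : ℕ) : Group (UnitalSeries 𝕜 m) :=
  letI : Mul (UnitalSeries 𝕜 m) := ⟨UnitalSeries.comp⟩
  letI : One (UnitalSeries 𝕜 m) := ⟨UnitalSeries.delta⟩
  letI : Inv (UnitalSeries 𝕜 m) := ⟨fun a => ⟨inv a.toSeries⟩⟩
  Group.ofRightAxioms comp_assoc comp_delta fun a =>
    UnitalSeries.ext (inv_add_mixedComp a.toSeries)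

/-! ### The pre-Lie identity -/

/-- This is the infinitesimal form of `scalarComp_shuffle`. Plain induction on the word suffices, as
the recursion evaluates the unknown only at the tail. -/
theorem scalarPreLie_shuffle (d : Series 𝕜 m) (e f : ScalarSeries 𝕜 m) :
    scalarPreLie d (shuffle e f) =
      shuffle (scalarPreLie d e) f + shuffle e (scalarPreLie d f) := by
  ext ν
  induction ν generalizing e f with
  | nil => simp [scalarPreLie_apply_nil, shuffle_apply_nil]
  | cons j ζ ih =>
    simp only [Pi.add_apply, scalarPreLie_apply_cons, shuffle_apply_cons, shift_scalarPreLie,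
      shift_shuffle, scalarPreLie_add, ih, add_shuffle, shuffle_add]
    split_ifs
    · simp only [sum_shuffle, shuffle_sum, shuffle_assoc, Finset.sum_apply,
        Finset.sum_add_distrib, shuffle_left_comm e]
      ring
    · simp [shuffle_zero, zero_shuffle]
      ring

/-- By the derivation rule, the terms `(v[i] ◁ w) ⧢ ∂_i e` cancel in the associator. What remains
beyond the inductive term is `∑_i (v[i] ⧢ (∂_i e ◁ w) + w[i] ⧢ (∂_i e ◁ v))`, symmetric in `v` and
`w`. -/
theorem scalarPreLie_associator_symm (v w : Series 𝕜 m) (e : ScalarSeries 𝕜 m) :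
    scalarPreLie w (scalarPreLie v e) - scalarPreLie (preLie v w) e =
      scalarPreLie v (scalarPreLie w e) - scalarPreLie (preLie w v) e := by
  ext ν
  induction ν generalizing e with
  | nil => simp [scalarPreLie_apply_nil]
  | cons j ζ ih =>
    have h := ih (shift j e)
    simp only [Pi.sub_apply] at h ⊢
    simp only [scalarPreLie_apply_cons, shift_scalarPreLie, scalarPreLie_add, shuffle_add,
      apply_ite (scalarPreLie _), scalarPreLie_zero, component_preLie, Pi.add_apply,
      ite_shuffle_component _ _ (_ = 0) id]
    split_ifs
    · simp only [scalarPreLie_sum, scalarPreLie_shuffle, Finset.sum_add_distrib, Finset.sum_apply,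
        Pi.zero_apply, Pi.add_apply]
      linear_combination h
    · simpa using h

theorem preLie_associator_symm (a v w : Series 𝕜 m) :
    preLie (preLie a v) w - preLie a (preLie v w) =
      preLie (preLie a w) v - preLie a (preLie w v) :=
  series_ext fun i => by
    have h := scalarPreLie_associator_symm v w (coord a i)
    simp only [← coord_preLie] at h
    exact h

end


/-! ### Directional derivatives of scalar and series valued functions -/

section DirDeriv

variable {𝕜 : Type*} [RCLike 𝕜] {E : Type*} [AddCommGroup E] [Module 𝕜 E] {m : ℕ}

theorem hasDirDerivAt_iff_hasDerivAt {f : E → 𝕜} {x v : E} {z : 𝕜} :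
    HasDirDerivAt 𝕜 f x v z ↔ HasDerivAt (fun t : 𝕜 => f (x + t • v)) z 0 := by
  simp [HasDirDerivAt, hasDerivAt_iff_tendsto_slope_zero]

theorem hasDirDerivAt_series_iff {f : E → Series 𝕜 m} {x v : E} {z : Series 𝕜 m} :
    HasDirDerivAt 𝕜 f x v z ↔
      ∀ ν i, HasDerivAt (fun t : 𝕜 => f (x + t • v) ν i) (z ν i) 0 := by
  rw [HasDirDerivAt]
  simp only [tendsto_pi_nhds]
  exact forall_congr' fun ν => forall_congr' fun i =>
    hasDirDerivAt_iff_hasDerivAt (f := fun x => f x ν i)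

end DirDeriv

/-! ### Polynomial maps are smooth -/

section Polynomial

variable (𝕜 : Type*) [RCLike 𝕜] (E : Type*) [AddCommGroup E] [Module 𝕜 E] [TopologicalSpace E]

/-- The continuous polynomial functions on `E`: the algebra generated by the continuous linear
functionals. -/
def polyFun : Subalgebra 𝕜 (E → 𝕜) := Algebra.adjoin 𝕜 (Set.range fun l : E →L[𝕜] 𝕜 => ⇑l)

variable {𝕜 E}

theorem coe_mem_polyFun (l : E →L[𝕜] 𝕜) : ⇑l ∈ polyFun 𝕜 E :=
  Algebra.subset_adjoin ⟨l, rfl⟩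

theorem comp_mem_polyFun {F : Type*} [AddCommGroup F] [Module 𝕜 F] [TopologicalSpace F]
    {f : F → 𝕜} (hf : f ∈ polyFun 𝕜 F) (L : E →L[𝕜] F) : (fun x => f (L x)) ∈ polyFun 𝕜 E := by
  induction hf using Algebra.adjoin_induction with
  | mem f hf =>
    obtain ⟨l, rfl⟩ := hf
    exact coe_mem_polyFun (l.comp L)
  | algebraMap r => exact (polyFun 𝕜 E).algebraMap_mem r
  | add f g _ _ hf hg => exact add_mem hf hg
  | mul f g _ _ hf hg => exact mul_mem hf hg

theorem continuous_of_mem_polyFun {f : E → 𝕜} (hf : f ∈ polyFun 𝕜 E) : Continuous f := by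
  induction hf using Algebra.adjoin_induction with
  | mem f hf =>
    obtain ⟨l, rfl⟩ := hf
    exact l.continuous
  | algebraMap r => exact continuous_const
  | add f g _ _ hf hg => exact hf.add hg
  | mul f g _ _ hf hg => exact hf.mul hg

/-- The map `(x, y_1, …, y_{k+1}) ↦ (x, y_1, …, y_k)`. -/
def dropLast (𝕜 : Type*) [RCLike 𝕜] (E : Type*) [AddCommGroup E] [Module 𝕜 E]
    [TopologicalSpace E] (k : ℕ) : E × (Fin (k + 1) → E) →L[𝕜] E × (Fin k → E) :=
  (ContinuousLinearMap.fst 𝕜 E (Fin (k + 1) → E)).prod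
    (ContinuousLinearMap.pi fun i =>
      (ContinuousLinearMap.proj (R := 𝕜) (φ := fun _ : Fin (k + 1) => E) i.castSucc).comp
        (ContinuousLinearMap.snd 𝕜 E (Fin (k + 1) → E)))

theorem dropLast_snoc {k : ℕ} (x v : E) (y : Fin k → E) :
    dropLast 𝕜 E k (x, Fin.snoc y v) = (x, y) := by
  ext i
  · rfl
  · exact Fin.snoc_castSucc (α := fun _ => E) v y i

/-- The derivative in `x` along a new direction `v` is again polynomial, now in one more variable;
this makes differentiation iterable. -/
theorem exists_hasDerivAt_of_mem_polyFun {k : ℕ} {f : E × (Fin k → E) → 𝕜}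
    (hf : f ∈ polyFun 𝕜 (E × (Fin k → E))) :
    ∃ g ∈ polyFun 𝕜 (E × (Fin (k + 1) → E)), ∀ (x : E) (y : Fin k → E) (v : E),
      HasDerivAt (fun t : 𝕜 => f (x + t • v, y)) (g (x, Fin.snoc y v)) 0 := by
  induction hf using Algebra.adjoin_induction with
  | mem f hf =>
    obtain ⟨l, rfl⟩ := hf
    -- The derivative is `l (v, 0)`, where `v` is the last entry of `Fin.snoc y v`.
    refine ⟨_, coe_mem_polyFun (((l.comp (ContinuousLinearMap.inl 𝕜 E (Fin k → E))).comp
      (ContinuousLinearMap.proj (R := 𝕜) (φ := fun _ : Fin (k + 1) => E) (Fin.last k))).comp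
        (ContinuousLinearMap.snd 𝕜 E (Fin (k + 1) → E))), fun x y v => ?_⟩
    have h (t : 𝕜) : l (x + t • v, y) = l (x, y) + t * l (v, 0) := by
      rw [← smul_eq_mul, ← map_smul, ← map_add]
      simp
    simp only [h]
    simpa using ((hasDerivAt_id (0 : 𝕜)).mul_const (l (v, 0))).const_add (l (x, y))
  | algebraMap r =>
    exact ⟨0, zero_mem _, fun x y v => hasDerivAt_const _ _⟩
  | add f₁ f₂ _ _ h₁ h₂ =>
    obtain ⟨g₁, hg₁, h₁⟩ := h₁
    obtain ⟨g₂, hg₂, h₂⟩ := h₂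
    exact ⟨g₁ + g₂, add_mem hg₁ hg₂, fun x y v => (h₁ x y v).add (h₂ x y v)⟩
  | mul f₁ f₂ hf₁ hf₂ h₁ h₂ =>
    obtain ⟨g₁, hg₁, h₁⟩ := h₁
    obtain ⟨g₂, hg₂, h₂⟩ := h₂
    refine ⟨_, add_mem (mul_mem hg₁ (comp_mem_polyFun hf₂ (dropLast 𝕜 E k)))
      (mul_mem (comp_mem_polyFun hf₁ (dropLast 𝕜 E k)) hg₂), fun x y v => ?_⟩
    have h := (h₁ x y v).mul (h₂ x y v)
    simp only [zero_smul, add_zero] at h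
    simp only [Pi.add_apply, Pi.mul_apply, dropLast_snoc]
    exact h

theorem isSmooth_of_mem_polyFun {f : E → 𝕜} (hf : f ∈ polyFun 𝕜 E) : IsSmooth 𝕜 f := by
  choose g hg hg' using fun (k : ℕ) (f : polyFun 𝕜 (E × (Fin k → E))) =>
    exists_hasDerivAt_of_mem_polyFun f.2
  -- The iterated derivatives are built inside the polynomial algebras, so membership is available
  -- to choose the next one.
  let D : (k : ℕ) → polyFun 𝕜 (E × (Fin k → E)) := fun k =>
    Nat.rec ⟨_, comp_mem_polyFun hf (ContinuousLinearMap.fst 𝕜 E (Fin 0 → E))⟩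
      (fun k d => ⟨g k d, hg k d⟩) k
  refine ⟨fun k x y => (D k).1 (x, y), fun x y => rfl, fun k x y v => ?_, fun k =>
    continuous_of_mem_polyFun (D k).2⟩
  exact hasDirDerivAt_iff_hasDerivAt.2 (hg' k (D k) x y v)

variable {m : ℕ}

theorem isSmooth_series_of_mem_polyFun {f : E → Series 𝕜 m}
    (hf : ∀ ν i, (fun x => f x ν i) ∈ polyFun 𝕜 E) : IsSmooth 𝕜 f := by
  choose D h₀ h₁ h₂ using fun ν i => isSmooth_of_mem_polyFun (hf ν i)
  refine ⟨fun k x y ν i => D ν i k x y, fun x y => ?_, fun k x y v => ?_, fun k => ?_⟩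
  · ext ν i
    exact h₀ ν i x y
  · exact hasDirDerivAt_series_iff.2 fun ν i => hasDirDerivAt_iff_hasDerivAt.1 (h₁ ν i k x y v)
  · exact continuous_pi fun ν => continuous_pi fun i => h₂ ν i k

end Polynomial

/-! ### Dependence of the coefficients on parameters -/

section Parameters

variable {𝕜 : Type*} [RCLike 𝕜] {m : ℕ} {X : Type*} (A : Subalgebra 𝕜 (X → 𝕜))

theorem const_mem_subalgebra (a : 𝕜) : (fun _ => a) ∈ A := A.algebraMap_mem a

/-- The subalgebra `A` is left arbitrary to serve two purposes: with `polyFun` these lemmas yield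
smoothness, with the polynomial functions of `t` they yield the remainder estimate. -/
theorem shuffle_mem {e f : X → ScalarSeries 𝕜 m} {ν : Word m}
    (he : ∀ ξ : Word m, ξ.length ≤ ν.length → (fun x => e x ξ) ∈ A)
    (hf : ∀ ξ : Word m, ξ.length ≤ ν.length → (fun x => f x ξ) ∈ A) :
    (fun x => shuffle (e x) (f x) ν) ∈ A := by
  induction ν generalizing e f with
  | nil =>
    simp only [shuffle_apply_nil]
    exact mul_mem (he [] le_rfl) (hf [] le_rfl)
  | cons j ζ ih =>
    simp only [shuffle_apply_cons]
    refine add_mem (ih (fun ξ hξ => he (j :: ξ) ?_) fun ξ hξ => hf ξ ?_)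
      (ih (fun ξ hξ => he ξ ?_) fun ξ hξ => hf (j :: ξ) ?_) <;>
    simp only [List.length_cons] <;> omega

theorem component_mem {c : X → Series 𝕜 m} {ν : Word m} (hc : ∀ i, (fun x => c x ν i) ∈ A)
    (i : Fin (m + 1)) : (fun x => component (c x) i ν) ∈ A := by
  cases i using Fin.cases with
  | zero => exact zero_mem A
  | succ i => exact hc i

theorem sum_fun_mem {ι : Type*} {s : Finset ι} {f : ι → X → 𝕜} (hf : ∀ i ∈ s, f i ∈ A) :
    (fun x => ∑ i ∈ s, f i x) ∈ A := by
  rw [← Finset.sum_fn]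
  exact sum_mem hf

theorem scalarComp_mem {c : X → Series 𝕜 m} (hc : ∀ ν i, (fun x => c x ν i) ∈ A)
    {e : X → ScalarSeries 𝕜 m} (he : ∀ ν, (fun x => e x ν) ∈ A) (ν : Word m) :
    (fun x => scalarComp (c x) (e x) ν) ∈ A := by
  induction hn : ν.length using Nat.strong_induction_on generalizing ν e with
  | _ n ih =>
    subst hn
    rcases ν with _ | ⟨j, ζ⟩
    · simpa only [scalarComp_apply_nil] using he []
    simp only [scalarComp_apply_cons]
    have h (ξ : Word m) (hξ : ξ.length ≤ ζ.length) (i : Fin (m + 1)) :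
        (fun x => scalarComp (c x) (shift i (e x)) ξ) ∈ A :=
      ih _ (by simpa using Nat.lt_succ_of_le hξ) (fun ν => he (i :: ν)) ξ rfl
    refine add_mem (h ζ le_rfl j) ?_
    split_ifs
    · exact sum_fun_mem A fun i _ => shuffle_mem A (fun ξ _ => component_mem A (hc ξ) i)
        fun ξ hξ => h ξ hξ i
    · exact zero_mem A

theorem mixedComp_mem {b c : X → Series 𝕜 m} (hb : ∀ ν i, (fun x => b x ν i) ∈ A)
    (hc : ∀ ν i, (fun x => c x ν i) ∈ A) (ν : Word m) (i : Fin m) :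
    (fun x => mixedComp (b x) (c x) ν i) ∈ A := by
  have h := scalarComp_mem A hc (e := fun x => coord (b x) i) (fun ν => hb ν i) ν
  simp only [← coord_mixedComp] at h
  exact h

theorem scalarPreLie_mem (v : Series 𝕜 m) {e : X → ScalarSeries 𝕜 m}
    (he : ∀ ν, (fun x => e x ν) ∈ A) (ν : Word m) :
    (fun x => scalarPreLie v (e x) ν) ∈ A := by
  induction ν generalizing e with
  | nil =>
    simp only [scalarPreLie_apply_nil]
    exact zero_mem A
  | cons j ζ ih =>
    simp only [scalarPreLie_apply_cons]
    refine add_mem (ih fun ν => he (j :: ν)) ?_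
    split_ifs
    · exact sum_fun_mem A fun i _ => shuffle_mem A (fun ξ _ => const_mem_subalgebra A _)
        fun ξ _ => he (i :: ξ)
    · exact zero_mem A

theorem preLie_mem (v : Series 𝕜 m) {c : X → Series 𝕜 m}
    (hc : ∀ ν i, (fun x => c x ν i) ∈ A) (ν : Word m) (i : Fin m) :
    (fun x => preLie (c x) v ν i) ∈ A := by
  have h := scalarPreLie_mem A v (e := fun x => coord (c x) i) (fun ν => hc ν i) ν
  simp only [← coord_preLie] at h
  exact h

theorem invApprox_mem {c : X → Series 𝕜 m} (hc : ∀ ν i, (fun x => c x ν i) ∈ A) (n : ℕ)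
    (ν : Word m) (i : Fin m) : (fun x => invApprox (c x) n ν i) ∈ A := by
  induction n generalizing ν i with
  | zero => exact zero_mem A
  | succ n ih => exact neg_mem (mixedComp_mem A hc ih ν i)

end Parameters

/-! ### Derivatives of coefficients along curves -/

section Derivative

variable {𝕜 : Type*} [RCLike 𝕜] {m : ℕ} {t₀ : 𝕜}

theorem hasDerivAt_shuffle {e f : 𝕜 → ScalarSeries 𝕜 m} {e' f' : ScalarSeries 𝕜 m} {ν : Word m}
    (he : ∀ ξ : Word m, ξ.length ≤ ν.length → HasDerivAt (fun t => e t ξ) (e' ξ) t₀)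
    (hf : ∀ ξ : Word m, ξ.length ≤ ν.length → HasDerivAt (fun t => f t ξ) (f' ξ) t₀) :
    HasDerivAt (fun t => shuffle (e t) (f t) ν)
      (shuffle e' (f t₀) ν + shuffle (e t₀) f' ν) t₀ := by
  induction ν generalizing e f e' f' with
  | nil =>
    simp only [shuffle_apply_nil]
    exact (he [] le_rfl).mul (hf [] le_rfl)
  | cons j ζ ih =>
    simp only [shuffle_apply_cons]
    have h₁ := ih (e := fun t => shift j (e t)) (e' := shift j e') (f := f) (f' := f')
      (fun ξ hξ => he (j :: ξ) (by simpa using hξ)) fun ξ hξ => hf ξ (by simp; omega)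
    have h₂ := ih (f := fun t => shift j (f t)) (f' := shift j f') (e := e) (e' := e')
      (fun ξ hξ => he ξ (by simp; omega)) fun ξ hξ => hf (j :: ξ) (by simpa using hξ)
    convert! h₁.add h₂ using 1
    ring

theorem hasDerivAt_component {c : 𝕜 → Series 𝕜 m} {c' : Series 𝕜 m} {ν : Word m}
    (hc : ∀ i, HasDerivAt (fun t => c t ν i) (c' ν i) t₀) (i : Fin (m + 1)) :
    HasDerivAt (fun t => component (c t) i ν) (component c' i ν) t₀ := by
  cases i using Fin.cases with
  | zero => exact hasDerivAt_const _ _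
  | succ i => exact hc i

/-- The derivative of the mixed composition of `e` with `δ + c t`, along a curve whose velocity at
`t₀` is the value of the left invariant vector field with value `v` at the unit. -/
theorem hasDerivAt_scalarComp {c : 𝕜 → Series 𝕜 m} {v : Series 𝕜 m}
    (hc : ∀ ν i, HasDerivAt (fun t => c t ν i) ((v + preLie (c t₀) v) ν i) t₀)
    (e : ScalarSeries 𝕜 m) (ν : Word m) :
    HasDerivAt (fun t => scalarComp (c t) e ν) (scalarPreLie v (scalarComp (c t₀) e) ν) t₀ := by
  induction hn : ν.length using Nat.strong_induction_on generalizing ν e with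
  | _ n ih =>
    subst hn
    rcases ν with _ | ⟨j, ζ⟩
    · simp only [scalarComp_apply_nil, scalarPreLie_apply_nil]
      exact hasDerivAt_const _ _
    have h (ξ : Word m) (hξ : ξ.length ≤ ζ.length) (i : Fin (m + 1)) :
        HasDerivAt (fun t => scalarComp (c t) (shift i e) ξ)
          (scalarPreLie v (scalarComp (c t₀) (shift i e)) ξ) t₀ :=
      ih _ (by simpa using Nat.lt_succ_of_le hξ) (shift i e) ξ rfl
    simp only [scalarComp_apply_cons]
    by_cases hj : j = 0
    · simp only [if_pos hj]
      convert! (h ζ le_rfl j).add (HasDerivAt.fun_sum fun i (_ : i ∈ Finset.univ) =>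
        hasDerivAt_shuffle (fun ξ _ => hasDerivAt_component (hc ξ) i) fun ξ hξ => h ξ hξ i) using 1
      -- The part `c[i] ◁ v` of the velocity completes the derivation rule for `_ ◁ v` on `c[i] ⧢
      -- _`; the part `v[i]` gives the `x_0`-term in the recursion for `◁`.
      simp only [scalarPreLie_apply_cons, shift_scalarComp, if_pos hj, scalarPreLie_add,
        scalarPreLie_sum, scalarPreLie_shuffle, shuffle_add, component_add, component_preLie,
        add_shuffle, Pi.add_apply, Finset.sum_apply, Finset.sum_add_distrib,
        ite_shuffle_component v _ (_ = 0) id, Pi.zero_apply, Finset.sum_const_zero]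
      ring
    · simp only [if_neg hj, add_zero, scalarPreLie_apply_cons, shift_scalarComp]
      exact h ζ le_rfl j

end Derivative

/-! ### The Lie group and its Lie algebra -/

section Main

variable {𝕜 : Type*} [RCLike 𝕜] {m : ℕ}

/-- The coefficient `c ↦ (c, ν)[i]` as a continuous linear functional. -/
def coeffCLM (𝕜 : Type*) [RCLike 𝕜] {m : ℕ} (ν : Word m) (i : Fin m) : Series 𝕜 m →L[𝕜] 𝕜 :=
  (ContinuousLinearMap.proj (R := 𝕜) (φ := fun _ : Fin m => 𝕜) i).comp
    (ContinuousLinearMap.proj (R := 𝕜) (φ := fun _ : Word m => Fin m → 𝕜) ν)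

theorem coeff_mem_polyFun (ν : Word m) (i : Fin m) :
    (fun c : Series 𝕜 m => c ν i) ∈ polyFun 𝕜 (Series 𝕜 m) :=
  coe_mem_polyFun (coeffCLM 𝕜 ν i)

theorem isSmooth_comp : IsSmooth 𝕜 fun p : Series 𝕜 m × Series 𝕜 m =>
    (UnitalSeries.comp ⟨p.1⟩ ⟨p.2⟩).toSeries := by
  have h₁ (ν : Word m) (i : Fin m) := comp_mem_polyFun (coeff_mem_polyFun ν i)
    (ContinuousLinearMap.fst 𝕜 (Series 𝕜 m) (Series 𝕜 m))
  have h₂ (ν : Word m) (i : Fin m) := comp_mem_polyFun (coeff_mem_polyFun ν i)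
    (ContinuousLinearMap.snd 𝕜 (Series 𝕜 m) (Series 𝕜 m))
  exact isSmooth_series_of_mem_polyFun fun ν i =>
    add_mem (h₂ ν i) (mixedComp_mem _ h₁ h₂ ν i)

theorem isSmooth_inv : IsSmooth 𝕜 (inv : Series 𝕜 m → Series 𝕜 m) :=
  isSmooth_series_of_mem_polyFun fun ν i => invApprox_mem _ coeff_mem_polyFun (ν.length + 1) ν i

theorem isLieGroup_unitalSeries :
    letI := unitalSeriesGroup 𝕜 m
    IsLieGroup 𝕜 (UnitalSeries.chart 𝕜 m) :=
  letI := unitalSeriesGroup 𝕜 m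
  ⟨isSmooth_comp, isSmooth_inv⟩

/-- The left invariant vector field with value `v` at the unit. -/
noncomputable def leftField (v : Series 𝕜 m) (g : UnitalSeries 𝕜 m) : Series 𝕜 m := v + preLie g.toSeries v

theorem zero_preLie (v : Series 𝕜 m) : preLie 0 v = 0 := (isLinearMap_preLie_left v).map_zero

theorem leftField_delta (v : Series 𝕜 m) : leftField v .delta = v := by
  simp [leftField, UnitalSeries.delta, zero_preLie]

theorem hasDerivAt_line (h w : Series 𝕜 m) (ν : Word m) (i : Fin m) :
    HasDerivAt (fun t : 𝕜 => (h + t • w) ν i) (w ν i) 0 := by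
  simpa using ((hasDerivAt_id (0 : 𝕜)).mul_const (w ν i)).const_add (h ν i)

/-- Left translation by `g` sends `x` to `x + g ∘ x`, with `∘` mixed composition. Its derivative at
`h` along `v + h ◁ v` is `v + h ◁ v + (g ∘ h) ◁ v`, the field at the product. -/
theorem hasDirDerivAt_leftField (v : Series 𝕜 m) (g h : UnitalSeries 𝕜 m) :
    HasDirDerivAt 𝕜 (fun x => (g.comp ⟨x⟩).toSeries) h.toSeries (leftField v h)
      (leftField v (g.comp h)) := by
  rw [hasDirDerivAt_series_iff]
  intro ν i
  have hl := hasDerivAt_line h.toSeries (leftField v h)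
  have hc := hasDerivAt_scalarComp (t₀ := 0) (v := v)
    (c := fun t : 𝕜 => h.toSeries + t • leftField v h) (by simpa [leftField] using hl)
    (coord g.toSeries i) ν
  simp only [← coord_mixedComp, ← coord_preLie, zero_smul, add_zero] at hc
  convert! (hl ν i).add hc using 1
  simp only [leftField, UnitalSeries.comp, preLie_add_left, ← add_assoc]
  rfl

theorem isLeftInvariant_leftField (v : Series 𝕜 m) :
    letI := unitalSeriesGroup 𝕜 m
    IsLeftInvariant 𝕜 (UnitalSeries.chart 𝕜 m) (leftField v) :=
  letI := unitalSeriesGroup 𝕜 m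
  { smooth := isSmooth_series_of_mem_polyFun fun ν i =>
      add_mem (const_mem_subalgebra _ (v ν i)) (preLie_mem _ v coeff_mem_polyFun ν i)
    invariant := hasDirDerivAt_leftField v }

/-- Invariance at `δ` makes the value at `g` a derivative of left translation, and limits in the
Hausdorff model space are unique. -/
theorem eq_leftField {V : UnitalSeries 𝕜 m → Series 𝕜 m}
    (hV : letI := unitalSeriesGroup 𝕜 m; IsLeftInvariant 𝕜 (UnitalSeries.chart 𝕜 m) V) :
    V = leftField (V .delta) := by
  let _ := unitalSeriesGroup 𝕜 m
  ext1 g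
  have h₁ := hV.invariant g .delta
  have h₂ := hasDirDerivAt_leftField (V .delta) g .delta
  rw [leftField_delta] at h₂
  have h := tendsto_nhds_unique h₁ h₂
  change V (g.comp .delta) = _ at h
  rwa [comp_delta] at h

theorem hasDirDerivAt_leftField_self (w x u : Series 𝕜 m) :
    HasDirDerivAt 𝕜 (fun x : Series 𝕜 m => leftField w ⟨x⟩) x u (preLie u w) := by
  -- The field is affine, so its difference quotient is constant for `t ≠ 0`.
  refine tendsto_const_nhds.congr' ?_
  filter_upwards [self_mem_nhdsWithin] with t ht
  simp only [leftField, preLie_add_left, preLie_smul_left]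
  rw [add_sub_add_left_eq_sub, add_sub_cancel_left, inv_smul_smul₀ ht]

theorem preLie_sub_left (a b d : Series 𝕜 m) : preLie (a - b) d = preLie a d - preLie b d :=
  (isLinearMap_preLie_left d).map_sub a b

theorem preLie_sub_right (c a b : Series 𝕜 m) : preLie c (a - b) = preLie c a - preLie c b :=
  (isLinearMap_preLie_right c).map_sub a b

/-- At `g` the bracket is `(v + g ◁ v) ◁ w - (w + g ◁ w) ◁ v`, and the pre-Lie identity turns its
`g`-part into `g ◁ (v ◁ w - w ◁ v)`. -/
theorem isFieldBracket_leftField (v w : Series 𝕜 m) :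
    IsFieldBracket 𝕜 (UnitalSeries.chart 𝕜 m) (leftField v) (leftField w)
      (leftField (preLie v w - preLie w v)) := by
  refine fun g => ⟨_, _, hasDirDerivAt_leftField_self w g.toSeries (leftField v g),
    hasDirDerivAt_leftField_self v g.toSeries (leftField w g), ?_⟩
  have h := preLie_associator_symm g.toSeries v w
  simp only [leftField, preLie_sub_right, preLie_add_left]
  linear_combination (exp := 1) -h

theorem preLie_jacobi (u v w : Series 𝕜 m) :
    (preLie u (preLie v w - preLie w v) - preLie (preLie v w - preLie w v) u) +
    (preLie v (preLie w u - preLie u w) - preLie (preLie w u - preLie u w) v) +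
    (preLie w (preLie u v - preLie v u) - preLie (preLie u v - preLie v u) w) = 0 := by
  have h₁ := preLie_associator_symm u v w
  have h₂ := preLie_associator_symm v w u
  have h₃ := preLie_associator_symm w u v
  simp only [preLie_sub_left, preLie_sub_right]
  linear_combination (exp := 1) -h₁ - h₂ - h₃

theorem isLieAlgebraOf_unitalSeries :
    letI := unitalSeriesGroup 𝕜 m
    IsLieAlgebraOf 𝕜 (UnitalSeries.chart 𝕜 m)
      (fun c d : Series 𝕜 m => preLie c d - preLie d c) :=
  letI := unitalSeriesGroup 𝕜 m
  { add_left := fun u v w => by rw [preLie_add_left, preLie_add_right]; abel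
    smul_left := fun t u v => by rw [preLie_smul_left, preLie_smul_right, smul_sub]
    add_right := fun u v w => by rw [preLie_add_left, preLie_add_right]; abel
    smul_right := fun t u v => by rw [preLie_smul_left, preLie_smul_right, smul_sub]
    self := fun u => sub_self _
    jacobi := preLie_jacobi
    existsUnique_field := fun v => ⟨leftField v, ⟨isLeftInvariant_leftField v, leftField_delta v⟩,
      fun V hV => (eq_leftField hV.1).trans (congrArg leftField hV.2)⟩
    field_bracket := fun V W hV hW => by
      refine ⟨_, isLeftInvariant_leftField (preLie (V 1) (W 1) - preLie (W 1) (V 1)), ?_,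
        leftField_delta _⟩
      have h := isFieldBracket_leftField (V .delta) (W .delta)
      rwa [← eq_leftField hV, ← eq_leftField hW] at h }

/-! ### The remainder of the product -/

theorem exists_polynomial_mixedComp (c d : Series 𝕜 m) (ν : Word m) (i : Fin m) :
    ∃ P : Polynomial 𝕜, ∀ t : 𝕜, mixedComp c (t • d) ν i = P.eval t := by
  have hd (ν : Word m) (i : Fin m) :
      -- The range of `Polynomial.aeval` at the identity function is the algebra of polynomial
      -- functions of `t`.
      (fun t : 𝕜 => (t • d) ν i) ∈ (Polynomial.aeval (R := 𝕜) (id : 𝕜 → 𝕜)).range :=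
    ⟨Polynomial.X * Polynomial.C (d ν i), by ext t; simp [mul_comm (d ν i)]⟩
  obtain ⟨P, hP⟩ := mixedComp_mem (b := fun _ => c) _
    (fun ν i => const_mem_subalgebra _ (c ν i)) hd ν i
  refine ⟨P, fun t => ?_⟩
  have h := congrFun hP t
  simp only [RingHom.coe_coe, AlgHom.toRingHom_eq_coe, Polynomial.aeval_fn_apply] at h
  simpa using h.symm

theorem exists_polynomial_remainder (c d : Series 𝕜 m) (ν : Word m) (i : Fin m) :
    ∃ P : Polynomial 𝕜, ∀ t : 𝕜,
      (mixedComp c (t • d) - c - preLie c (t • d)) ν i = t ^ 2 * P.eval t := by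
  obtain ⟨P, hP⟩ := exists_polynomial_mixedComp c d ν i
  have h₀ : P.eval 0 = c ν i := by rw [← hP 0, zero_smul, mixedComp_zero_right]
  have h₁ : P.derivative.eval 0 = preLie c d ν i := by
    -- The line `t • d` has velocity `d = d + 0 ◁ d` at `0`, as the derivative formula for invariant
    -- fields requires.
    have h := hasDerivAt_scalarComp (t₀ := 0) (v := d) (c := fun t : 𝕜 => 0 + t • d)
      (by simpa [zero_preLie] using hasDerivAt_line 0 d) (coord c i) ν
    simp only [zero_add, zero_smul, ← coord_mixedComp, ← coord_preLie, mixedComp_zero_right] at h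
    simp only [coord, hP] at h
    exact (P.hasDerivAt 0).unique h
  -- The coefficients of degrees `0` and `1` are `P(0)` and `P'(0)`, which the subtracted terms
  -- cancel.
  obtain ⟨Q, hQ⟩ : Polynomial.X ^ 2 ∣
      P - Polynomial.C (c ν i) - Polynomial.X * Polynomial.C (preLie c d ν i) := by
    rw [Polynomial.X_pow_dvd_iff]
    intro k hk
    interval_cases k
    · simp [Polynomial.coeff_zero_eq_eval_zero, h₀]
    · rw [← Polynomial.coeff_zero_eq_eval_zero, Polynomial.coeff_derivative] at h₁
      simp [← h₁, Polynomial.coeff_C]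
  refine ⟨Q, fun t => ?_⟩
  have h := congrArg (Polynomial.eval t) hQ
  simp only [Polynomial.eval_sub, Polynomial.eval_mul, Polynomial.eval_pow, Polynomial.eval_X,
    Polynomial.eval_C, ← hP] at h
  rw [← h, preLie_smul_right]
  rfl

end Main

end ChenFliess

theorem mainTheorem9 (𝕜 : Type*) [RCLike 𝕜] (m : ℕ) :
    -- the model space is a Fréchet space
    (LocallyConvexSpace ℝ (Series 𝕜 m) ∧ CompleteSpace (Series 𝕜 m) ∧
      TopologicalSpace.MetrizableSpace (Series 𝕜 m)) ∧
    -- the product makes the affine space a Lie group, whose Lie algebra is as described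
    (∃ _ : Group (UnitalSeries 𝕜 m),
      (∀ a b : UnitalSeries 𝕜 m, a * b = a.comp b) ∧
      (1 : UnitalSeries 𝕜 m) = UnitalSeries.delta ∧
      IsLieGroup 𝕜 (UnitalSeries.chart 𝕜 m) ∧
      IsLieAlgebraOf 𝕜 (UnitalSeries.chart 𝕜 m)
        (fun c d : Series 𝕜 m => preLie c d - preLie d c)) ∧
    -- the pre-Lie product is bilinear and is the linear part of the group product
    (∀ d : Series 𝕜 m, IsLinearMap 𝕜 fun c : Series 𝕜 m => preLie c d) ∧
    (∀ c : Series 𝕜 m, IsLinearMap 𝕜 fun d : Series 𝕜 m => preLie c d) ∧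
    ∃ R : Series 𝕜 m → Series 𝕜 m → Series 𝕜 m,
      (∀ c d : Series 𝕜 m,
        UnitalSeries.comp ⟨c⟩ ⟨d⟩ = ⟨c + d + preLie c d + R c d⟩) ∧
      (∀ d : Series 𝕜 m, IsLinearMap 𝕜 fun c : Series 𝕜 m => R c d) ∧
      ∀ (c d : Series 𝕜 m) (η : Word m) (i : Fin m),
        ∃ P : Polynomial 𝕜, ∀ t : 𝕜, R c (t • d) η i = t ^ 2 * P.eval t := by
  refine ⟨⟨inferInstance, inferInstance, inferInstance⟩,
    ⟨unitalSeriesGroup 𝕜 m, fun _ _ => rfl, rfl, isLieGroup_unitalSeries,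
      isLieAlgebraOf_unitalSeries⟩,
    isLinearMap_preLie_left, isLinearMap_preLie_right,
    fun c d => mixedComp c d - c - preLie c d, fun c d => ?_, fun d => ?_,
    exists_polynomial_remainder⟩
  · ext1
    simp only [UnitalSeries.comp]
    abel
  · constructor
    · intro a b
      beta_reduce
      rw [(isLinearMap_mixedComp d).map_add, preLie_add_left]
      abel
    · intro t a
      beta_reduce
      rw [(isLinearMap_mixedComp d).map_smul, preLie_smul_left, smul_sub, smul_sub]
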